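/- All graphs are finite, simple and undirected. For a connected graph $G$ let $D(G)$ be its distance matrix and $\lambda_1(D(G))$ the largest eigenvalue of $D(G)$. Write $G\cup H$ for the disjoint union and $G\vee H$ for the join of two graphs, and put $S_{n,m}=K_m\vee (n-m)K_1$. For a graph $H$ let $i(H)$ be the number of its isolated vertices. For an even integer $k\ge 2$, a $k$-barrier of $G$ is a set $S\subseteq V(G)$ that maximizes $k\cdot i(G-S)-k|S|$ over all subsets of $V(G)$. A connected graph of odd (respectively even) order is called $\mathrm{GFC}_k$ (respectively $\mathrm{GBC}_k$) if it has no non-empty $k$-barrier. **Theorem.** Let $k\ge 2$ be an even integer and let $G$ be a connected graph of order $n\ge 3$. (i) If $\lambda_1(D(G))\le\lambda_1(D(K_1\vee(K_{n-2}\cup K_1)))$, then, unless $G\cong K_1\vee(K_{n-2}\cup K_1)$, $G$ is $\mathrm{GFC}_k$ if $n$ is odd, and $G$ is $\mathrm{GBC}_k$ if $n$ is even and $n\ge 10$. (ii) If $n$ is even, $4\le n\le 8$ and $\lambda_1(D(G))\le\lambda_1(D(S_{n,n/2}))$, then $G$ is $\mathrm{GBC}_k$ unless $G\cong S_{n,n/2}$.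 -/

import Mathlib

namespace DistMatching

noncomputable section

/-- The distance matrix `D(G)`: its `(u, v)` entry is the length of a shortest path from `u` to `v`. -/
def distMatrix {V : Type*} (G : SimpleGraph V) : Matrix V V ℝ :=
  Matrix.of fun u v => (G.dist u v : ℝ)

theorem distMatrix_isHermitian {V : Type*} (G : SimpleGraph V) : (distMatrix G).IsHermitian := by
  ext u v
  simp [distMatrix, Matrix.conjTranspose_apply, SimpleGraph.dist_comm]

open Classical in
/-- The distance spectral radius `λ₁(D(G))`: the largest eigenvalue of the distance matrix
(a finite supremum, over a nonempty set of eigenvalues as soon as the graph has a vertex). -/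
def distSpectralRadius {V : Type*} [Fintype V] (G : SimpleGraph V) : ℝ :=
  ⨆ v : V, (distMatrix_isHermitian G).eigenvalues v

/-- The graph `G - S`. -/
def deleteVerts {V : Type*} (G : SimpleGraph V) (S : Finset V) :
    SimpleGraph {v : V // v ∉ S} :=
  G.comap Subtype.val

/-- The number `i(G)` of isolated vertices. -/
def numIsolated {V : Type*} (G : SimpleGraph V) : ℕ :=
  {v : V | G.IsIsolated v}.ncard

/-- The number `odd(G)` of nontrivial odd components, that is, of components with an odd number
of vertices and more than one vertex. -/
def numNontrivialOdd {V : Type*} (G : SimpleGraph V) : ℕ :=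
  {c : G.ConnectedComponent | Odd c.supp.ncard ∧ 1 < c.supp.ncard}.ncard

/-- The expression maximized in the `k`-Berge–Tutte formula. -/
def bergeTutteValue {V : Type*} (G : SimpleGraph V) (k : ℕ) (S : Finset V) : ℤ :=
  if Even k then
    (k : ℤ) * (numIsolated (deleteVerts G S) : ℤ) - (k : ℤ) * (S.card : ℤ)
  else
    (numNontrivialOdd (deleteVerts G S) : ℤ) + (k : ℤ) * (numIsolated (deleteVerts G S) : ℤ)
      - (k : ℤ) * (S.card : ℤ)

/-- The `k`-Berge–Tutte formula `def_k(G)`, a maximum over all vertex subsets. -/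
def bergeTutteDef {V : Type*} [Fintype V] (G : SimpleGraph V) (k : ℕ) : ℤ :=
  (Finset.univ : Finset (Finset V)).sup' Finset.univ_nonempty (bergeTutteValue G k)

/-- A `k`-barrier: a vertex subset that reaches the maximum in the `k`-Berge–Tutte formula. -/
def IsBarrier {V : Type*} [Fintype V] (G : SimpleGraph V) (k : ℕ) (S : Finset V) : Prop :=
  bergeTutteValue G k S = bergeTutteDef G k

/-- `G` is `GFC_k`: connected, of odd order, without nonempty `k`-barrier. -/
def IsGFC {V : Type*} [Fintype V] (G : SimpleGraph V) (k : ℕ) : Prop :=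
  G.Connected ∧ Odd (Fintype.card V) ∧ ∀ S : Finset V, S.Nonempty → ¬ IsBarrier G k S

/-- `G` is `GBC_k`: connected, of even order, without nonempty `k`-barrier. -/
def IsGBC {V : Type*} [Fintype V] (G : SimpleGraph V) (k : ℕ) : Prop :=
  G.Connected ∧ Even (Fintype.card V) ∧ ∀ S : Finset V, S.Nonempty → ¬ IsBarrier G k S

/-- The join `G ∨ H`: the disjoint union together with all edges between the two parts. -/
def graphJoin {V W : Type*} (G : SimpleGraph V) (H : SimpleGraph W) : SimpleGraph (V ⊕ W) :=
  (G ⊕g H) ⊔ completeBipartiteGraph V W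

/-- The graph `K₁ ∨ (K_{n-2} ∪ K₁)`, of order `n` when `n ≥ 2`. -/
def extremalGraph (n : ℕ) : SimpleGraph (Fin 1 ⊕ (Fin (n - 2) ⊕ Fin 1)) :=
  graphJoin (⊤ : SimpleGraph (Fin 1))
    ((⊤ : SimpleGraph (Fin (n - 2))) ⊕g (⊤ : SimpleGraph (Fin 1)))

/-- The graph `S_{n,m} = K_m ∨ (n - m)K₁`, of order `n` when `m ≤ n`. -/
def splitGraph (n m : ℕ) : SimpleGraph (Fin m ⊕ Fin (n - m)) :=
  graphJoin (⊤ : SimpleGraph (Fin m)) (⊥ : SimpleGraph (Fin (n - m)))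

end

end DistMatching

open Matrix

namespace DistMatching

/-! ### The largest eigenvalue of a symmetric matrix -/

/-! For even `k` the empty set has value `k * i(G) ≥ 0`, so a non-empty barrier `S` leaves at least
`|S|` isolated vertices. Keep `|S|` of them as `T`: an independent set whose neighbours all lie in
`S` (`IsBarrier.exists_adj_mem`). This contradicts the spectral hypothesis in one of two ways.

If `|S| = 1` in (i), or `|S| = n / 2` in (ii), then `G` is a spanning subgraph of the extremal
graph. That graph has diameter at most two, so its distances are entrywise minimal, and testing with
its Perron vector forces an isomorphism (`distSpectralRadius_le_imp_iso`).

For other sizes a rational `θ` separates the two radii. A positive supersolution bounds that of the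
extremal graph above by `θ` (`distSpectralRadius_le_of_mulVec_le`), and a Rayleigh quotient puts
that of `G` above `θ` (`lt_distSpectralRadius_of_adj_mem`). -/

theorem posSemidef_iSup_eigenvalues_sub {ι : Type*} [Fintype ι] [DecidableEq ι]
    {A : Matrix ι ι ℝ} (hA : A.IsHermitian) :
    (algebraMap ℝ (Matrix ι ι ℝ) (⨆ i, hA.eigenvalues i) - A).PosSemidef := by
  have hB : (algebraMap ℝ (Matrix ι ι ℝ) (⨆ i, hA.eigenvalues i) - A).IsHermitian := by
    refine IsHermitian.sub ?_ hA
    rw [Algebra.algebraMap_eq_smul_one]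
    ext i j
    simp [Matrix.one_apply, eq_comm]
  rw [hB.posSemidef_iff_eigenvalues_nonneg]
  intro i
  have h := hB.eigenvalues_mem_spectrum_real i
  rw [← spectrum.singleton_sub_eq] at h
  obtain ⟨_, rfl, μ, hμ, h⟩ := h
  rw [hA.spectrum_real_eq_range_eigenvalues] at hμ
  obtain ⟨j, rfl⟩ := hμ
  simp only [Pi.zero_apply] at *
  rw [← h]
  exact sub_nonneg.2 (le_ciSup (Set.finite_range _).bddAbove j)

theorem dotProduct_mulVec_le_iSup_eigenvalues {ι : Type*} [Fintype ι] [DecidableEq ι]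
    {A : Matrix ι ι ℝ} (hA : A.IsHermitian) (x : ι → ℝ) :
    x ⬝ᵥ A *ᵥ x ≤ (⨆ i, hA.eigenvalues i) * (x ⬝ᵥ x) := by
  have h := (posSemidef_iSup_eigenvalues_sub hA).dotProduct_mulVec_nonneg x
  simp only [Algebra.algebraMap_eq_smul_one, sub_mulVec, smul_mulVec, one_mulVec, dotProduct_sub,
    dotProduct_smul, star_trivial, smul_eq_mul] at h
  linarith

/-- The Perron vector of a symmetric matrix that is positive off the diagonal. -/
theorem exists_pos_mulVec_eq_iSup_eigenvalues {ι : Type*} [Fintype ι] [DecidableEq ι]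
    [Nontrivial ι] {A : Matrix ι ι ℝ} (hA : A.IsHermitian) (h0 : ∀ i j, 0 ≤ A i j)
    (hpos : ∀ i j, i ≠ j → 0 < A i j) :
    ∃ w : ι → ℝ, (∀ i, 0 < w i) ∧ A *ᵥ w = (⨆ i, hA.eigenvalues i) • w := by
  obtain ⟨j, hj⟩ := Finite.exists_max hA.eigenvalues
  have hsup : ⨆ i, hA.eigenvalues i = hA.eigenvalues j :=
    le_antisymm (ciSup_le hj) (le_ciSup (Set.finite_range _).bddAbove j)
  set ρ := ⨆ i, hA.eigenvalues i with hρ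
  obtain ⟨z, hz0, hz⟩ : ∃ z : ι → ℝ, z ≠ 0 ∧ A *ᵥ z = ρ • z := by
    refine ⟨⇑(hA.eigenvectorBasis j), fun h => ?_, by rw [hA.mulVec_eigenvectorBasis, hsup]⟩
    have := hA.eigenvectorBasis.orthonormal.ne_zero j
    exact this (by ext i; exact congrFun h i)
  let w : ι → ℝ := fun i => |z i|
  have hww : w ⬝ᵥ w = z ⬝ᵥ z := by simp [dotProduct, w]
  have hle : ρ * (w ⬝ᵥ w) ≤ w ⬝ᵥ A *ᵥ w := by
    have : ρ * (w ⬝ᵥ w) = z ⬝ᵥ A *ᵥ z := by rw [hz, hww, dotProduct_smul, smul_eq_mul]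
    rw [this]
    simp only [dotProduct, mulVec, Finset.mul_sum]
    refine Finset.sum_le_sum fun i _ => Finset.sum_le_sum fun k _ => ?_
    calc z i * (A i k * z k) ≤ |z i * (A i k * z k)| := le_abs_self _
      _ = w i * (A i k * w k) := by rw [abs_mul, abs_mul, abs_of_nonneg (h0 i k)]
  -- Passing to absolute values keeps the Rayleigh quotient maximal, so `w` is a null vector of the
  -- semidefinite form `ρ - A`, hence in its kernel.
  have hw : A *ᵥ w = ρ • w := by
    have hP := posSemidef_iSup_eigenvalues_sub hA
    have h := (hP.dotProduct_mulVec_zero_iff w).1 (by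
      have h1 := dotProduct_mulVec_le_iSup_eigenvalues hA w
      simp only [Algebra.algebraMap_eq_smul_one, sub_mulVec, smul_mulVec, one_mulVec,
        dotProduct_sub, dotProduct_smul, star_trivial, smul_eq_mul]
      linarith)
    simp only [Algebra.algebraMap_eq_smul_one, sub_mulVec, smul_mulVec, one_mulVec] at h
    exact (sub_eq_zero.1 h).symm
  refine ⟨w, fun i => ?_, hw⟩
  by_contra hi
  have hwi : w i = 0 := le_antisymm (not_lt.1 hi) (abs_nonneg _)
  obtain ⟨k, hk⟩ := Function.ne_iff.1 hz0
  have hwk : 0 < w k := abs_pos.2 hk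
  have hik : i ≠ k := by rintro rfl; exact hi hwk
  have h1 : (A *ᵥ w) i = 0 := by rw [hw]; simp [hwi]
  have h2 : A i k * w k ≤ (A *ᵥ w) i :=
    Finset.single_le_sum (f := fun j => A i j * w j)
      (fun j _ => mul_nonneg (h0 i j) (abs_nonneg _)) (Finset.mem_univ k)
  have := mul_pos (hpos i k hik) hwk
  linarith

/-! ### The distance spectral radius -/

theorem dotProduct_distMatrix_mulVec_le {V : Type*} [Fintype V] (G : SimpleGraph V) (x : V → ℝ) :
    x ⬝ᵥ distMatrix G *ᵥ x ≤ distSpectralRadius G * (x ⬝ᵥ x) := by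
  classical
  exact dotProduct_mulVec_le_iSup_eigenvalues (distMatrix_isHermitian G) x

theorem exists_pos_distMatrix_mulVec_eq {V : Type*} [Fintype V] [Nontrivial V]
    {G : SimpleGraph V} (hG : G.Connected) :
    ∃ w : V → ℝ, (∀ v, 0 < w v) ∧ distMatrix G *ᵥ w = distSpectralRadius G • w := by
  classical
  refine exists_pos_mulVec_eq_iSup_eigenvalues (distMatrix_isHermitian G) (fun u v => ?_)
    fun u v h => ?_
  · exact Nat.cast_nonneg _
  · exact Nat.cast_pos.2 (hG.pos_dist_of_ne h)

/-- Collatz–Wielandt bound: pair the supersolution `x` with the Perron vector and move the symmetric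
matrix across. -/
theorem distSpectralRadius_le_of_mulVec_le {V : Type*} [Fintype V] [Nontrivial V]
    {G : SimpleGraph V} (hG : G.Connected) {x : V → ℝ} (hx : ∀ v, 0 < x v) {θ : ℝ}
    (h : ∀ u, ∑ v, (G.dist u v : ℝ) * x v ≤ θ * x u) : distSpectralRadius G ≤ θ := by
  obtain ⟨w, hw, hρ⟩ := exists_pos_distMatrix_mulVec_eq hG
  have hpos : 0 < w ⬝ᵥ x := Finset.sum_pos (fun v _ => mul_pos (hw v) (hx v)) Finset.univ_nonempty
  have h1 : w ⬝ᵥ distMatrix G *ᵥ x = distSpectralRadius G * (w ⬝ᵥ x) := by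
    have hT : (distMatrix G)ᵀ = distMatrix G := by
      simpa [conjTranspose_eq_transpose_of_trivial] using (distMatrix_isHermitian G).eq
    rw [dotProduct_mulVec, ← mulVec_transpose, hT, hρ, smul_dotProduct, smul_eq_mul]
  have h2 : w ⬝ᵥ distMatrix G *ᵥ x ≤ θ * (w ⬝ᵥ x) := by
    rw [dotProduct, dotProduct, Finset.mul_sum]
    refine Finset.sum_le_sum fun u _ => ?_
    have := mul_le_mul_of_nonneg_left (h u) (hw u).le
    calc w u * (distMatrix G *ᵥ x) u ≤ w u * (θ * x u) := this
      _ = θ * (w u * x u) := by ring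
  exact le_of_mul_le_mul_right (h1 ▸ h2) hpos

/-! ### Graphs of diameter at most two -/

theorem dist_le_two {V : Type*} {G : SimpleGraph V} {u v w : V} (h : G.Adj u w)
    (h' : G.Adj w v) : G.dist u v ≤ 2 := by
  simpa using SimpleGraph.dist_le (SimpleGraph.Walk.cons h (SimpleGraph.Walk.cons h' .nil))

/-- Non-adjacent pairs of `H` are at distance two, the least possible in `G`, so `D(H) ≤ D(G)`
entrywise. The Perron vector of `H` is positive, so a single strict entry would make the radius of
`G` larger; equal distances give equal adjacency. -/
theorem distSpectralRadius_le_imp_iso {V W : Type*} [Fintype V] [Fintype W] [Nontrivial W]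
    {G : SimpleGraph V} {H : SimpleGraph W} (hG : G.Connected) (hH : H.Connected)
    (hdist : ∀ u v, H.dist u v ≤ 2) (e : W ≃ V) (he : ∀ u v, G.Adj (e u) (e v) → H.Adj u v)
    (h : distSpectralRadius G ≤ distSpectralRadius H) : Nonempty (G ≃g H) := by
  obtain ⟨w, hw, hρ⟩ := exists_pos_distMatrix_mulVec_eq hH
  have hmono : ∀ u v, H.dist u v ≤ G.dist (e u) (e v) := by
    intro u v
    by_cases huv : u = v
    · simp [huv]
    have hne : e u ≠ e v := e.injective.ne huv
    by_cases hadj : G.Adj (e u) (e v)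
    · rw [SimpleGraph.dist_eq_one_iff_adj.2 (he u v hadj)]
      exact hG.pos_dist_of_ne hne
    · exact (hdist u v).trans (hG.one_lt_dist_of_ne_of_not_adj hne hadj)
  have h1 := dotProduct_distMatrix_mulVec_le G (w ∘ e.symm)
  have h2 : (w ∘ e.symm) ⬝ᵥ (w ∘ e.symm) = w ⬝ᵥ w := by
    simp only [dotProduct]
    exact e.symm.sum_comp (fun i => w i * w i)
  have h3 : (w ∘ e.symm) ⬝ᵥ distMatrix G *ᵥ (w ∘ e.symm) =
      ∑ u, ∑ v, w u * ((G.dist (e u) (e v) : ℝ) * w v) := by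
    simp only [dotProduct, mulVec, Finset.mul_sum]
    rw [← e.sum_comp]
    refine Finset.sum_congr rfl fun u _ => ?_
    rw [← e.sum_comp]
    simp [distMatrix]
  have h4 : ∑ u, ∑ v, w u * ((H.dist u v : ℝ) * w v) = distSpectralRadius H * (w ⬝ᵥ w) := by
    have : w ⬝ᵥ distMatrix H *ᵥ w = distSpectralRadius H * (w ⬝ᵥ w) := by
      rw [hρ, dotProduct_smul, smul_eq_mul]
    rw [← this]
    simp [dotProduct, mulVec, Finset.mul_sum, distMatrix]
  have hww : 0 ≤ w ⬝ᵥ w := Finset.sum_nonneg fun v _ => mul_self_nonneg _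
  have hterm : ∀ u v, w u * ((H.dist u v : ℝ) * w v) ≤ w u * ((G.dist (e u) (e v) : ℝ) * w v) :=
    fun u v => mul_le_mul_of_nonneg_left (mul_le_mul_of_nonneg_right
      (Nat.cast_le.2 (hmono u v)) (hw v).le) (hw u).le
  have hsum : ∑ u, ∑ v, w u * ((H.dist u v : ℝ) * w v) =
      ∑ u, ∑ v, w u * ((G.dist (e u) (e v) : ℝ) * w v) := by
    refine le_antisymm (Finset.sum_le_sum fun u _ => Finset.sum_le_sum fun v _ => hterm u v) ?_
    rw [← h3, h4]
    rw [h2] at h1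
    exact h1.trans (mul_le_mul_of_nonneg_right h hww)
  have hdisteq : ∀ u v, H.dist u v = G.dist (e u) (e v) := by
    intro u v
    have hu := (Finset.sum_eq_sum_iff_of_le
      fun u _ => Finset.sum_le_sum fun v _ => hterm u v).1 hsum u (Finset.mem_univ u)
    have huv := (Finset.sum_eq_sum_iff_of_le fun v _ => hterm u v).1 hu v (Finset.mem_univ v)
    have := mul_right_cancel₀ (hw v).ne' (mul_left_cancel₀ (hw u).ne' huv)
    exact_mod_cast this
  refine ⟨(⟨e, ?_⟩ : H ≃g G).symm⟩
  intro u v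
  rw [← SimpleGraph.dist_eq_one_iff_adj, ← SimpleGraph.dist_eq_one_iff_adj, hdisteq]

/-! ### Bounds for a graph with a set of independent vertices with few neighbours -/

/-- If all neighbours of the vertices of `T` lie in `S`, the vector equal to `a` on `S`, to `c` on
`T`, and to `b` elsewhere, gives a lower bound for the distance spectral radius. -/
theorem lt_distSpectralRadius_of_adj_mem {V : Type*} [Fintype V] {G : SimpleGraph V}
    (hG : G.Connected) {S T : Finset V} (hST : Disjoint S T)
    (hT : ∀ u ∈ T, ∀ v, G.Adj u v → v ∈ S) {s r a b c θ : ℝ} (hS : (S.card : ℝ) = s)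
    (hTs : (T.card : ℝ) = s) (hr : (Fintype.card V : ℝ) = 2 * s + r)
    (ha : 0 ≤ a) (hb : 0 ≤ b) (hc : 0 ≤ c)
    (h : θ * (s * a ^ 2 + r * b ^ 2 + s * c ^ 2) <
      (s * a + r * b + s * c) ^ 2 - (s * a ^ 2 + r * b ^ 2 + s * c ^ 2) + s * (s - 1) * c ^ 2
        + 2 * s * r * b * c) : θ < distSpectralRadius G := by
  classical
  let p : V → ℝ := fun v => if v ∈ S then 1 else 0
  let t : V → ℝ := fun v => if v ∈ T then 1 else 0
  let q : V → ℝ := fun v => 1 - p v - t v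
  let y : V → ℝ := fun v => a * p v + b * q v + c * t v
  have hp : ∑ v, p v = s := by simp [p, hS]
  have ht : ∑ v, t v = s := by simp [t, hTs]
  have hq : ∑ v, q v = r := by
    simp only [q, Finset.sum_sub_distrib, hp, ht]
    simp [hr]; ring
  have hy : ∑ v, y v = s * a + r * b + s * c := by
    simp only [y, Finset.sum_add_distrib, ← Finset.mul_sum, hp, hq, ht]; ring
  have hcase : ∀ v, (v ∈ S ∧ v ∉ T) ∨ (v ∉ S ∧ v ∈ T) ∨ (v ∉ S ∧ v ∉ T) := by
    intro v
    have : v ∈ S → v ∉ T := fun h => Finset.disjoint_left.1 hST h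
    tauto
  have hyy : ∀ v, y v * y v = a ^ 2 * p v + b ^ 2 * q v + c ^ 2 * t v := by
    intro v
    rcases hcase v with ⟨h1, h2⟩ | ⟨h1, h2⟩ | ⟨h1, h2⟩ <;> simp [y, p, q, t, h1, h2] <;> ring
  have hN : y ⬝ᵥ y = s * a ^ 2 + r * b ^ 2 + s * c ^ 2 := by
    simp only [dotProduct, hyy, Finset.sum_add_distrib, ← Finset.mul_sum, hp, hq, ht]; ring
  -- Every off-diagonal distance counts at least one, and one more for a pair with one vertex in `T`
  -- and the other outside `S`. The diagonal correction also cancels the extra `c ^ 2` that `t u * t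
  -- v` adds at `u = v`.
  have hent : ∀ u v, y u * y v - (if u = v then y u * y u + c ^ 2 * t u else 0)
      + c ^ 2 * (t u * t v) + b * c * (t u * q v) + b * c * (q u * t v)
      ≤ y u * ((G.dist u v : ℝ) * y v) := by
    intro u v
    by_cases huv : u = v
    · subst huv
      rcases hcase u with ⟨h1, h2⟩ | ⟨h1, h2⟩ | ⟨h1, h2⟩ <;> simp [y, p, q, t, h1, h2]
    have hd1 : (1 : ℝ) ≤ G.dist u v := by exact_mod_cast hG.pos_dist_of_ne huv
    have hd2 : (u ∈ T ∧ v ∉ S) ∨ (v ∈ T ∧ u ∉ S) → (2 : ℝ) ≤ G.dist u v := by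
      rintro (⟨h1, h2⟩ | ⟨h1, h2⟩)
      · exact_mod_cast hG.one_lt_dist_of_ne_of_not_adj huv fun h => h2 (hT u h1 v h)
      · exact_mod_cast hG.one_lt_dist_of_ne_of_not_adj huv fun h => h2 (hT v h1 u h.symm)
    have key : ∀ α β d : ℝ, 0 ≤ α → 0 ≤ β → d ≤ G.dist u v →
        α * β * d ≤ α * ((G.dist u v : ℝ) * β) := by
      intro α β d hα hβ hd
      have := mul_le_mul_of_nonneg_left hd (mul_nonneg hα hβ)
      linarith
    rcases hcase u with ⟨h1, h2⟩ | ⟨h1, h2⟩ | ⟨h1, h2⟩ <;>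
    rcases hcase v with ⟨h3, h4⟩ | ⟨h3, h4⟩ | ⟨h3, h4⟩ <;>
    simp only [y, p, q, t, h1, h2, h3, h4, huv, if_true, if_false]
    · linarith [key a a 1 ha ha hd1]
    · linarith [key a c 1 ha hc hd1]
    · linarith [key a b 1 ha hb hd1]
    · linarith [key c a 1 hc ha hd1]
    · linarith [key c c 2 hc hc (hd2 (by tauto))]
    · linarith [key c b 2 hc hb (hd2 (by tauto))]
    · linarith [key b a 1 hb ha hd1]
    · linarith [key b c 2 hb hc (hd2 (by tauto))]
    · linarith [key b b 1 hb hb hd1]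
  have hQ : (s * a + r * b + s * c) ^ 2 - (s * a ^ 2 + r * b ^ 2 + s * c ^ 2)
      + s * (s - 1) * c ^ 2 + 2 * s * r * b * c ≤ y ⬝ᵥ distMatrix G *ᵥ y := by
    have h1 : y ⬝ᵥ distMatrix G *ᵥ y = ∑ u, ∑ v, y u * ((G.dist u v : ℝ) * y v) := by
      simp [dotProduct, mulVec, Finset.mul_sum, distMatrix]
    rw [h1]
    refine le_trans (le_of_eq ?_)
      (Finset.sum_le_sum fun u _ => Finset.sum_le_sum fun v _ => hent u v)
    simp only [Finset.sum_add_distrib, Finset.sum_sub_distrib, ← Finset.mul_sum, hq, ht, hy,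
      Finset.sum_ite_eq, Finset.mem_univ, if_true, ← Finset.sum_mul]
    have : ∑ v, y v * y v = s * a ^ 2 + r * b ^ 2 + s * c ^ 2 := hN
    rw [this]
    ring
  have hub := dotProduct_distMatrix_mulVec_le G y
  have hlt : θ * (y ⬝ᵥ y) < distSpectralRadius G * (y ⬝ᵥ y) := by
    rw [hN] at hub ⊢
    linarith
  exact lt_of_mul_lt_mul_right hlt (Finset.sum_nonneg fun v _ => mul_self_nonneg _)

/-- A nonempty `k`-barrier contains all neighbours of some set of vertices of its own size. -/
theorem IsBarrier.exists_adj_mem {V : Type*} [Fintype V] {G : SimpleGraph V} {k : ℕ}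
    (hk : 2 ≤ k) (hk_even : Even k) {S : Finset V} (hS : IsBarrier G k S) :
    ∃ T : Finset V, T.card = S.card ∧ Disjoint S T ∧ ∀ u ∈ T, ∀ v, G.Adj u v → v ∈ S := by
  classical
  have h0 : 0 ≤ bergeTutteValue G k S := by
    rw [hS]
    refine le_trans ?_ (Finset.le_sup' (bergeTutteValue G k) (Finset.mem_univ ∅))
    simp [bergeTutteValue, hk_even]
    positivity
  simp only [bergeTutteValue, hk_even, if_true] at h0
  have hcard : S.card ≤ numIsolated (deleteVerts G S) := by
    have hk0 : (0 : ℤ) < k := by omega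
    have : (k : ℤ) * S.card ≤ k * numIsolated (deleteVerts G S) := by linarith
    exact_mod_cast le_of_mul_le_mul_left this hk0
  let I : Set {v // v ∉ S} := {v | (deleteVerts G S).IsIsolated v}
  have hI : I.ncard = numIsolated (deleteVerts G S) := rfl
  rw [← hI, Set.ncard_eq_toFinset_card' I] at hcard
  obtain ⟨T, hTI, hTc⟩ := Finset.exists_subset_card_eq hcard
  refine ⟨T.map (Function.Embedding.subtype _), by simpa using hTc, ?_, ?_⟩
  · rw [Finset.disjoint_left]
    intro v hv hv'
    simp only [Finset.mem_map, Function.Embedding.subtype_apply] at hv'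
    obtain ⟨w, -, rfl⟩ := hv'
    exact w.2 hv
  · intro u hu v huv
    simp only [Finset.mem_map, Function.Embedding.subtype_apply] at hu
    obtain ⟨w, hw, rfl⟩ := hu
    by_contra hv
    have := hTI hw
    simp only [I, Set.mem_toFinset, Set.mem_ofPred_eq] at this
    exact this ⟨v, hv⟩ huv

/-! ### The two extremal graphs -/

theorem extremalGraph_adj {n : ℕ} (u v : Fin 1 ⊕ (Fin (n - 2) ⊕ Fin 1)) :
    (extremalGraph n).Adj u v ↔ u ≠ v ∧ (u.isLeft ∨ v.isLeft ∨
      ((Sum.elim (fun _ => false) Sum.isLeft u) ∧ (Sum.elim (fun _ => false) Sum.isLeft v))) := by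
  rcases u with u | u | u <;> rcases v with v | v | v <;>
    simp [extremalGraph, graphJoin, eq_iff_true_of_subsingleton]

theorem splitGraph_adj {n m : ℕ} (u v : Fin m ⊕ Fin (n - m)) :
    (splitGraph n m).Adj u v ↔ u ≠ v ∧ (u.isLeft ∨ v.isLeft) := by
  rcases u with u | u <;> rcases v with v | v <;> simp [splitGraph, graphJoin]


theorem connected_of_forall_adj {V : Type*} {G : SimpleGraph V} {c : V}
    (h : ∀ v, v ≠ c → G.Adj c v) : G.Connected := by
  have hr : ∀ v, G.Reachable c v := fun v => by
    by_cases hv : v = c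
    · rw [hv]
    · exact (h v hv).reachable
  exact { preconnected := fun u v => (hr u).symm.trans (hr v), nonempty := ⟨c⟩ }

theorem dist_le_two_of_forall_adj {V : Type*} {G : SimpleGraph V} {c : V}
    (h : ∀ v, v ≠ c → G.Adj c v) (u v : V) : G.dist u v ≤ 2 := by
  by_cases hu : u = c
  · by_cases hv : v = c
    · simp [hu, hv]
    · rw [hu, SimpleGraph.dist_eq_one_iff_adj.2 (h v hv)]; norm_num
  · by_cases hv : v = c
    · rw [hv, SimpleGraph.dist_eq_one_iff_adj.2 (h u hu).symm]; norm_num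
    · exact dist_le_two (h u hu).symm (h v hv)

theorem extremalGraph_adj_inl {n : ℕ} (v : Fin 1 ⊕ (Fin (n - 2) ⊕ Fin 1)) (hv : v ≠ Sum.inl 0) :
    (extremalGraph n).Adj (Sum.inl 0) v :=
  (extremalGraph_adj _ _).2 ⟨hv.symm, Or.inl rfl⟩

theorem splitGraph_adj_inl {n m : ℕ} (i : Fin m) (v : Fin m ⊕ Fin (n - m)) (hv : v ≠ Sum.inl i) :
    (splitGraph n m).Adj (Sum.inl i) v :=
  (splitGraph_adj _ _).2 ⟨hv.symm, Or.inl rfl⟩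

/-- Row sum over the cell that contains the vertex itself: its own zero distance accounts for the `-
1`. The primed version needs no such membership. -/
theorem sum_dist_mul_le {ι : Type*} [Fintype ι] {V : Type*} (G : SimpleGraph V) (f : ι → V)
    (i : ι) {d : ℕ} (h : ∀ j, G.dist (f i) (f j) ≤ d) {b : ℝ} (hb : 0 ≤ b) :
    ∑ j, (G.dist (f i) (f j) : ℝ) * b ≤ d * (Fintype.card ι - 1) * b := by
  classical
  rw [← Finset.add_sum_erase _ _ (Finset.mem_univ i), SimpleGraph.dist_self]
  have hc : ((Finset.univ.erase i).card : ℝ) = Fintype.card ι - 1 := by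
    rw [Finset.cast_card_erase_of_mem (Finset.mem_univ i), Finset.card_univ]
  calc ((0 : ℕ) : ℝ) * b + ∑ j ∈ Finset.univ.erase i, (G.dist (f i) (f j) : ℝ) * b
      ≤ 0 + ∑ j ∈ Finset.univ.erase i, (d : ℝ) * b := by
        gcongr with j
        · simp
        · exact h j
    _ = d * (Fintype.card ι - 1) * b := by
        rw [Finset.sum_const, nsmul_eq_mul, hc]; ring

theorem sum_dist_mul_le' {ι : Type*} [Fintype ι] {V : Type*} (G : SimpleGraph V) (f : ι → V)
    (u : V) {d : ℕ} (h : ∀ j, G.dist u (f j) ≤ d) {b : ℝ} (hb : 0 ≤ b) :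
    ∑ j, (G.dist u (f j) : ℝ) * b ≤ d * Fintype.card ι * b := by
  calc ∑ j, (G.dist u (f j) : ℝ) * b ≤ ∑ _j : ι, (d : ℝ) * b := by
        gcongr with j
        exact h j
    _ = d * Fintype.card ι * b := by
        rw [Finset.sum_const, nsmul_eq_mul, Finset.card_univ]; ring

theorem dist_le_one_of_imp_adj {V : Type*} {G : SimpleGraph V} {u v : V}
    (h : u ≠ v → G.Adj u v) : G.dist u v ≤ 1 := by
  by_cases huv : u = v
  · simp [huv]
  · exact (SimpleGraph.dist_eq_one_iff_adj.2 (h huv)).le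

/-- The supersolution is constant on centre, clique and pendant vertex; the three inequalities are
the rows of the quotient matrix. -/
theorem distSpectralRadius_extremalGraph_le {n : ℕ} (hn : 3 ≤ n) {a b c θ : ℝ} (ha : 0 < a)
    (hb : 0 < b) (hc : 0 < c) (h1 : (n - 2) * b + c ≤ θ * a) (h2 : a + (n - 3) * b + 2 * c ≤ θ * b)
    (h3 : a + 2 * (n - 2) * b ≤ θ * c) : distSpectralRadius (extremalGraph n) ≤ θ := by
  have hcast : ((n - 2 : ℕ) : ℝ) = n - 2 := by push_cast [show 2 ≤ n by omega]; ring
  have : Nontrivial (Fin 1 ⊕ (Fin (n - 2) ⊕ Fin 1)) :=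
    ⟨⟨Sum.inl 0, Sum.inr (Sum.inr 0), by simp⟩⟩
  refine distSpectralRadius_le_of_mulVec_le (connected_of_forall_adj extremalGraph_adj_inl)
    (x := Sum.elim (fun _ => a) (Sum.elim (fun _ => b) (fun _ => c))) ?_ ?_
  · rintro (v | v | v) <;> simpa
  · rintro (u | u | u) <;> simp only [Fintype.sum_sum_type, Sum.elim_inl, Sum.elim_inr]
    · have e1 := sum_dist_mul_le (extremalGraph n) Sum.inl u (d := 0) (b := a)
        (fun j => by simp [Subsingleton.elim u j]) ha.le
      have e2 := sum_dist_mul_le' (extremalGraph n) (fun j : Fin (n - 2) => Sum.inr (Sum.inl j))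
        (Sum.inl u) (d := 1) (b := b)
        (fun j => dist_le_one_of_imp_adj fun h => by simp [extremalGraph_adj]) hb.le
      have e3 := sum_dist_mul_le' (extremalGraph n) (fun j : Fin 1 => Sum.inr (Sum.inr j))
        (Sum.inl u) (d := 1) (b := c)
        (fun j => dist_le_one_of_imp_adj fun h => by simp [extremalGraph_adj]) hc.le
      simp only [Fintype.card_fin, hcast] at e1 e2 e3
      push_cast at e1 e2 e3
      linarith
    · have e1 := sum_dist_mul_le' (extremalGraph n) Sum.inl (Sum.inr (Sum.inl u)) (d := 1) (b := a)
        (fun j => dist_le_one_of_imp_adj fun h => by simp [extremalGraph_adj]) ha.le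
      have e2 := sum_dist_mul_le (extremalGraph n) (fun j : Fin (n - 2) => Sum.inr (Sum.inl j))
        u (d := 1) (b := b)
        (fun j => dist_le_one_of_imp_adj fun h => by simpa [extremalGraph_adj] using h) hb.le
      have e3 := sum_dist_mul_le' (extremalGraph n) (fun j : Fin 1 => Sum.inr (Sum.inr j))
        (Sum.inr (Sum.inl u)) (d := 2) (b := c)
        (fun j => dist_le_two_of_forall_adj extremalGraph_adj_inl _ _) hc.le
      simp only [Fintype.card_fin, hcast] at e1 e2 e3
      push_cast at e1 e2 e3
      linarith
    · have e1 := sum_dist_mul_le' (extremalGraph n) Sum.inl (Sum.inr (Sum.inr u)) (d := 1) (b := a)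
        (fun j => dist_le_one_of_imp_adj fun h => by simp [extremalGraph_adj]) ha.le
      have e2 := sum_dist_mul_le' (extremalGraph n) (fun j : Fin (n - 2) => Sum.inr (Sum.inl j))
        (Sum.inr (Sum.inr u)) (d := 2) (b := b)
        (fun j => dist_le_two_of_forall_adj extremalGraph_adj_inl _ _) hb.le
      have e3 := sum_dist_mul_le (extremalGraph n) (fun j : Fin 1 => Sum.inr (Sum.inr j))
        u (d := 0) (b := c) (fun j => by simp [Subsingleton.elim u j]) hc.le
      simp only [Fintype.card_fin, hcast] at e1 e2 e3
      push_cast at e1 e2 e3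
      linarith

theorem distSpectralRadius_splitGraph_le {n m : ℕ} (hm : 1 ≤ m) (hmn : m < n) {a c θ : ℝ}
    (ha : 0 < a) (hc : 0 < c) (h1 : (m - 1) * a + (n - m) * c ≤ θ * a)
    (h2 : m * a + 2 * (n - m - 1) * c ≤ θ * c) :
    distSpectralRadius (splitGraph n m) ≤ θ := by
  have hcast : ((n - m : ℕ) : ℝ) = n - m := by push_cast [hmn.le]; ring
  have huniv := splitGraph_adj_inl (n := n) (⟨0, hm⟩ : Fin m)
  have : Nontrivial (Fin m ⊕ Fin (n - m)) :=
    ⟨⟨Sum.inl ⟨0, hm⟩, Sum.inr ⟨0, by omega⟩, by simp⟩⟩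
  refine distSpectralRadius_le_of_mulVec_le (connected_of_forall_adj huniv)
    (x := Sum.elim (fun _ => a) (fun _ => c)) ?_ ?_
  · rintro (v | v) <;> simpa
  · rintro (u | u) <;> simp only [Fintype.sum_sum_type, Sum.elim_inl, Sum.elim_inr]
    · have e1 := sum_dist_mul_le (splitGraph n m) Sum.inl u (d := 1) (b := a)
        (fun j => dist_le_one_of_imp_adj fun h => by simpa [splitGraph_adj] using h) ha.le
      have e2 := sum_dist_mul_le' (splitGraph n m) Sum.inr (Sum.inl u) (d := 1) (b := c)
        (fun j => dist_le_one_of_imp_adj fun h => by simp [splitGraph_adj]) hc.le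
      simp only [Fintype.card_fin, hcast] at e1 e2
      push_cast at e1 e2
      linarith
    · have e1 := sum_dist_mul_le' (splitGraph n m) Sum.inl (Sum.inr u) (d := 1) (b := a)
        (fun j => dist_le_one_of_imp_adj fun h => by simp [splitGraph_adj]) ha.le
      have e2 := sum_dist_mul_le (splitGraph n m) Sum.inr u (d := 2) (b := c)
        (fun j => dist_le_two_of_forall_adj huniv _ _) hc.le
      simp only [Fintype.card_fin, hcast] at e1 e2
      push_cast at e1 e2
      linarith

/-! ### Embedding a graph with a barrier into an extremal graph -/

theorem two_mul_card_le {V : Type*} [Fintype V] {S T : Finset V} (hc : T.card = S.card)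
    (hST : Disjoint S T) : 2 * S.card ≤ Fintype.card V := by
  have := Finset.card_le_univ (S.disjUnion T hST)
  rw [Finset.card_disjUnion] at this
  omega

/-- The vertex of `T` can only be adjacent to the vertex of `S`: send them to the pendant vertex and
the centre, and all others to the clique. -/
theorem iso_extremalGraph_of_distSpectralRadius_le {V : Type*} [Fintype V] {G : SimpleGraph V}
    {n : ℕ} (hG : G.Connected) (hn : Fintype.card V = n) (hn3 : 3 ≤ n) {S T : Finset V}
    (hS : S.card = 1) (hTc : T.card = 1) (hST : Disjoint S T)
    (hT : ∀ u ∈ T, ∀ v, G.Adj u v → v ∈ S)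
    (h : distSpectralRadius G ≤ distSpectralRadius (extremalGraph n)) :
    Nonempty (G ≃g extremalGraph n) := by
  classical
  obtain ⟨p, rfl⟩ := Finset.card_eq_one.1 hS
  obtain ⟨q, rfl⟩ := Finset.card_eq_one.1 hTc
  have hpq : p ≠ q := by simpa using hST
  have hR : (Finset.univ \ {p, q} : Finset V).card = n - 2 := by
    rw [Finset.card_sdiff_of_subset (Finset.subset_univ _), Finset.card_univ, hn,
      Finset.card_pair hpq]
  let f := Finset.equivFinOfCardEq hR
  have hf : ∀ i, (f.symm i : V) ≠ p ∧ (f.symm i : V) ≠ q := by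
    intro i
    have := (f.symm i).2
    simp only [Finset.mem_sdiff, Finset.mem_insert, Finset.mem_singleton, not_or] at this
    exact this.2
  let g : Fin 1 ⊕ (Fin (n - 2) ⊕ Fin 1) → V :=
    Sum.elim (fun _ => p) (Sum.elim (fun i => (f.symm i : V)) (fun _ => q))
  have hinj : Function.Injective g := by
    rintro (u | u | u) (v | v | v) huv <;>
      simp [g, (hf _).1, (hf _).2, (hf _).1.symm, (hf _).2.symm, hpq, hpq.symm] at huv
    · simp [Subsingleton.elim u v]
    · simpa using huv
    · simp [Subsingleton.elim u v]
  have hbij : Function.Bijective g :=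
    (Fintype.bijective_iff_injective_and_card g).2 ⟨hinj, by simp [hn]; omega⟩
  have : Nontrivial (Fin 1 ⊕ (Fin (n - 2) ⊕ Fin 1)) :=
    ⟨⟨Sum.inl 0, Sum.inr (Sum.inr 0), by simp⟩⟩
  refine distSpectralRadius_le_imp_iso hG (connected_of_forall_adj extremalGraph_adj_inl)
    (dist_le_two_of_forall_adj extremalGraph_adj_inl) (Equiv.ofBijective g hbij) ?_ h
  intro u v huv
  have hq : ∀ w, G.Adj q w → w = p := by simpa using hT
  rw [extremalGraph_adj]
  refine ⟨fun h => huv.ne (by rw [h]), ?_⟩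
  rcases u with u | u | u <;> rcases v with v | v | v <;> simp [g] at huv ⊢
  · exact (hf _).1 (hq _ huv.symm)
  · exact (hf _).1 (hq _ huv)

/-- Here `S` and `T` exhaust the vertices and `T` is independent, so only edges meeting `S` occur.
-/
theorem iso_splitGraph_of_distSpectralRadius_le {V : Type*} [Fintype V] {G : SimpleGraph V}
    {n m : ℕ} (hG : G.Connected) (hn : Fintype.card V = n) (hm : 1 ≤ m) (hmn : n = 2 * m)
    {S T : Finset V} (hS : S.card = m) (hTc : T.card = m) (hST : Disjoint S T)
    (hT : ∀ u ∈ T, ∀ v, G.Adj u v → v ∈ S)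
    (h : distSpectralRadius G ≤ distSpectralRadius (splitGraph n m)) :
    Nonempty (G ≃g splitGraph n m) := by
  classical
  have hTc' : T.card = n - m := by omega
  let f := Finset.equivFinOfCardEq hS
  let f' := Finset.equivFinOfCardEq hTc'
  let g : Fin m ⊕ Fin (n - m) → V :=
    Sum.elim (fun i => (f.symm i : V)) (fun i => (f'.symm i : V))
  have hd : ∀ i j, (f.symm i : V) ≠ f'.symm j := fun i j =>
    Finset.disjoint_iff_ne.1 hST _ (f.symm i).2 _ (f'.symm j).2
  have hinj : Function.Injective g := by
    rintro (u | u) (v | v) huv <;> simp [g, hd, (hd _ _).symm] at huv ⊢ <;> simpa using huv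
  have hbij : Function.Bijective g :=
    (Fintype.bijective_iff_injective_and_card g).2 ⟨hinj, by simp [hn]; omega⟩
  have huniv := splitGraph_adj_inl (n := n) (⟨0, hm⟩ : Fin m)
  have : Nontrivial (Fin m ⊕ Fin (n - m)) :=
    ⟨⟨Sum.inl ⟨0, hm⟩, Sum.inr ⟨0, by omega⟩, by simp⟩⟩
  refine distSpectralRadius_le_imp_iso hG (connected_of_forall_adj huniv)
    (dist_le_two_of_forall_adj huniv) (Equiv.ofBijective g hbij) ?_ h
  intro u v huv
  rw [splitGraph_adj]
  refine ⟨fun h => huv.ne (by rw [h]), ?_⟩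
  rcases u with u | u <;> rcases v with v | v <;> simp [g] at huv ⊢
  exact Finset.disjoint_left.1 hST (hT _ (f'.symm u).2 _ huv) (f'.symm v).2

/-! ### Comparison of the spectral radii -/

theorem distSpectralRadius_extremalGraph_lt {V : Type*} [Fintype V] {G : SimpleGraph V}
    {n : ℕ} (hG : G.Connected) (hn : Fintype.card V = n) (hn' : Odd n ∨ 10 ≤ n) {S T : Finset V}
    (hS : 2 ≤ S.card) (hTc : T.card = S.card) (hST : Disjoint S T)
    (hT : ∀ u ∈ T, ∀ v, G.Adj u v → v ∈ S) :
    distSpectralRadius (extremalGraph n) < distSpectralRadius G := by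
  have h2 := two_mul_card_le hTc hST
  rw [hn] at h2
  obtain ⟨s, hs⟩ : ∃ s, S.card = s := ⟨_, rfl⟩
  rw [hs] at hS hTc h2
  -- Here `(a, b, c)` certifies the upper bound `θ` for the extremal graph, and `(x, y, z)` the
  -- strict lower bound for `G`.
  have key : ∀ a b c x y z θ : ℝ, 0 < a → 0 < b → 0 < c → 0 ≤ x → 0 ≤ y → 0 ≤ z →
      (n - 2) * b + c ≤ θ * a → a + (n - 3) * b + 2 * c ≤ θ * b → a + 2 * (n - 2) * b ≤ θ * c →
      θ * (s * x ^ 2 + (n - 2 * s) * y ^ 2 + s * z ^ 2) <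
        (s * x + (n - 2 * s) * y + s * z) ^ 2 - (s * x ^ 2 + (n - 2 * s) * y ^ 2 + s * z ^ 2)
          + s * (s - 1) * z ^ 2 + 2 * s * (n - 2 * s) * y * z →
      distSpectralRadius (extremalGraph n) < distSpectralRadius G :=
    fun a b c x y z θ ha hb hc hx hy hz h1 h2 h3 h4 =>
      (distSpectralRadius_extremalGraph_le (by omega) ha hb hc h1 h2 h3).trans_lt
        (lt_distSpectralRadius_of_adj_mem hG hST hT (by rw [hs]) (by rw [hTc])
          (by rw [hn]; ring) hx hy hz h4)
  by_cases h15 : 15 ≤ n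
  · have hsr : (2 : ℝ) ≤ s := by exact_mod_cast hS
    have hnr : (15 : ℝ) ≤ n := by exact_mod_cast h15
    have h2r : 2 * (s : ℝ) ≤ n := by exact_mod_cast h2
    refine key 1 1 2 1 1 1 (n + 2) ?_ ?_ ?_ ?_ ?_ ?_ ?_ ?_ ?_ ?_ <;> try linarith
    -- With the all-ones vector the claim is `3n < s(2n - 3s - 1)`, and the difference equals
    -- `(3/2)(s - 2)(n - 2s) + (1/2)s(n - 14)`; hence the threshold 15.
    nlinarith [mul_nonneg (sub_nonneg.2 hsr) (sub_nonneg.2 h2r),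
      mul_pos (show (0 : ℝ) < s by linarith) (show (0 : ℝ) < n - 14 by linarith)]
  · have hle : n ≤ 14 := by omega
    have hlo : 5 ≤ n := by rcases hn' with ⟨k, hk⟩ | h <;> omega
    have hcases : n = 5 ∨ n = 7 ∨ n = 9 ∨ n = 10 ∨ n = 11 ∨ n = 12 ∨ n = 13 ∨
        n = 14 := by
      rcases hn' with ⟨k, hk⟩ | h <;> omega
    have hs7 : s ≤ 7 := by omega
    clear hn hs hTc
    -- In each case `(a, b, c)` is a small integer vector, `θ` is the largest of its three row
    -- ratios, and one test vector serves every `s`.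
    rcases hcases with rfl | rfl | rfl | rfl | rfl | rfl | rfl | rfl
    · refine key 9 11 14 2 3 3 (59 / 11) ?_ ?_ ?_ ?_ ?_ ?_ ?_ ?_ ?_ ?_ <;> try norm_num
      interval_cases s <;> first | omega | norm_num
    · refine key 5 5 7 1 2 2 (55 / 7) ?_ ?_ ?_ ?_ ?_ ?_ ?_ ?_ ?_ ?_ <;> try norm_num
      interval_cases s <;> first | omega | norm_num
    · refine key 2 2 3 1 1 1 10 ?_ ?_ ?_ ?_ ?_ ?_ ?_ ?_ ?_ ?_ <;> try norm_num
      interval_cases s <;> first | omega | norm_num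
    · refine key 2 2 3 2 2 3 (34 / 3) ?_ ?_ ?_ ?_ ?_ ?_ ?_ ?_ ?_ ?_ <;> try norm_num
      interval_cases s <;> first | omega | norm_num
    · refine key 2 2 3 1 1 1 (38 / 3) ?_ ?_ ?_ ?_ ?_ ?_ ?_ ?_ ?_ ?_ <;> try norm_num
      interval_cases s <;> first | omega | norm_num
    · refine key 3 3 5 1 1 1 (40 / 3) ?_ ?_ ?_ ?_ ?_ ?_ ?_ ?_ ?_ ?_ <;> try norm_num
      interval_cases s <;> first | omega | norm_num
    · refine key 1 1 2 1 1 2 15 ?_ ?_ ?_ ?_ ?_ ?_ ?_ ?_ ?_ ?_ <;> try norm_num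
      interval_cases s <;> first | omega | norm_num
    · refine key 3 3 5 1 1 1 (46 / 3) ?_ ?_ ?_ ?_ ?_ ?_ ?_ ?_ ?_ ?_ <;> try norm_num
      interval_cases s <;> first | omega | norm_num

theorem distSpectralRadius_splitGraph_lt {V : Type*} [Fintype V] {G : SimpleGraph V}
    {n : ℕ} (hG : G.Connected) (hn : Fintype.card V = n) (hn_even : Even n) (hn4 : 4 ≤ n)
    (hn8 : n ≤ 8) {S T : Finset V} (hS : 1 ≤ S.card) (hS' : S.card ≠ n / 2)
    (hTc : T.card = S.card) (hST : Disjoint S T) (hT : ∀ u ∈ T, ∀ v, G.Adj u v → v ∈ S) :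
    distSpectralRadius (splitGraph n (n / 2)) < distSpectralRadius G := by
  have h2 := two_mul_card_le hTc hST
  rw [hn] at h2
  obtain ⟨s, hs⟩ : ∃ s, S.card = s := ⟨_, rfl⟩
  rw [hs] at hS hS' hTc h2
  have key : ∀ a c x y z θ : ℝ, 0 < a → 0 < c → 0 ≤ x → 0 ≤ y → 0 ≤ z →
      ((n / 2 : ℕ) - 1) * a + (n - (n / 2 : ℕ)) * c ≤ θ * a →
      (n / 2 : ℕ) * a + 2 * (n - (n / 2 : ℕ) - 1) * c ≤ θ * c →
      θ * (s * x ^ 2 + (n - 2 * s) * y ^ 2 + s * z ^ 2) <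
        (s * x + (n - 2 * s) * y + s * z) ^ 2 - (s * x ^ 2 + (n - 2 * s) * y ^ 2 + s * z ^ 2)
          + s * (s - 1) * z ^ 2 + 2 * s * (n - 2 * s) * y * z →
      distSpectralRadius (splitGraph n (n / 2)) < distSpectralRadius G :=
    fun a c x y z θ ha hc hx hy hz h1 h2 h4 =>
      (distSpectralRadius_splitGraph_le (by omega) (by omega) ha hc h1 h2).trans_lt
        (lt_distSpectralRadius_of_adj_mem hG hST hT (by rw [hs]) (by rw [hTc])
          (by rw [hn]; ring) hx hy hz h4)
  have hcases : n = 4 ∨ n = 6 ∨ n = 8 := by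
    obtain ⟨k, hk⟩ := hn_even
    omega
  have hs4 : s ≤ 4 := by omega
  clear hn hs hTc
  rcases hcases with rfl | rfl | rfl
  · refine key 1 1 2 3 3 4 ?_ ?_ ?_ ?_ ?_ ?_ ?_ ?_ <;> try norm_num
    interval_cases s <;> first | omega | norm_num
  · refine key 2 3 3 4 5 (13 / 2) ?_ ?_ ?_ ?_ ?_ ?_ ?_ ?_ <;> try norm_num
    interval_cases s <;> first | omega | norm_num
  -- The case `s = 1` gets a finer test vector of its own, while `s = 2` and `s = 3` share one.
  · by_cases h1 : s = 1
    · refine key 9 13 11 13 19 (79 / 9) ?_ ?_ ?_ ?_ ?_ ?_ ?_ ?_ <;> try norm_num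
      subst h1
      norm_num
    · refine key 9 13 2 3 3 (79 / 9) ?_ ?_ ?_ ?_ ?_ ?_ ?_ ?_ <;> try norm_num
      interval_cases s <;> first | omega | norm_num

end DistMatching

theorem theorem5 {V : Type*} [Fintype V] (G : SimpleGraph V) (k n : ℕ)
    (hk : 2 ≤ k) (hk_even : Even k) (hG : G.Connected)
    (hn : Fintype.card V = n) (hn3 : 3 ≤ n) :
    (DistMatching.distSpectralRadius G
        ≤ DistMatching.distSpectralRadius (DistMatching.extremalGraph n) →
      ¬ Nonempty (G ≃g DistMatching.extremalGraph n) →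
        (Odd n → DistMatching.IsGFC G k) ∧ (Even n → 10 ≤ n → DistMatching.IsGBC G k)) ∧
    (DistMatching.distSpectralRadius G
        ≤ DistMatching.distSpectralRadius (DistMatching.splitGraph n (n / 2)) →
      ¬ Nonempty (G ≃g DistMatching.splitGraph n (n / 2)) →
        Even n → 4 ≤ n → n ≤ 8 → DistMatching.IsGBC G k) := by
  constructor
  · intro hle hiso
    have key : Odd n ∨ 10 ≤ n →
        ∀ S : Finset V, S.Nonempty → ¬ DistMatching.IsBarrier G k S := by
      intro hn' S hS hbar
      obtain ⟨T, hTc, hST, hT⟩ := hbar.exists_adj_mem hk hk_even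
      by_cases h1 : S.card = 1
      · exact hiso (DistMatching.iso_extremalGraph_of_distSpectralRadius_le hG hn hn3 h1
          (hTc.trans h1) hST hT hle)
      · have hpos := hS.card_pos
        exact absurd hle (not_le.2 (DistMatching.distSpectralRadius_extremalGraph_lt hG hn hn'
          (by omega) hTc hST hT))
    exact ⟨fun ho => ⟨hG, hn ▸ ho, key (Or.inl ho)⟩,
      fun he h10 => ⟨hG, hn ▸ he, key (Or.inr h10)⟩⟩
  · intro hle hiso he h4 h8
    refine ⟨hG, hn ▸ he, fun S hS hbar => ?_⟩
    obtain ⟨T, hTc, hST, hT⟩ := hbar.exists_adj_mem hk hk_even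
    by_cases h1 : S.card = n / 2
    · exact hiso (DistMatching.iso_splitGraph_of_distSpectralRadius_le hG hn (by omega)
        (by obtain ⟨r, hr⟩ := he; omega) h1 (hTc.trans h1) hST hT hle)
    · exact absurd hle (not_le.2 (DistMatching.distSpectralRadius_splitGraph_lt hG hn he h4 h8
        hS.card_pos h1 hTc hST hT))
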